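/- Let $h\ge 1$, $q=2^h$ and $k\ge 3$. On $\mathbb F_q^k$ consider the pseudo-symplectic (symmetric, non-alternating, non-degenerate) bilinear form \[ \beta(x,y)=\begin{cases} x_1y_2+x_2y_1+\dots+x_{k-2}y_{k-1}+x_{k-1}y_{k-2}+x_ky_k & \text{if } k \text{ is odd},\\ x_1y_2+x_2y_1+\dots+x_{k-1}y_k+x_ky_{k-1}+x_ky_k & \text{if } k \text{ is even},\end{cases} \] and let $\perp$ be the associated polarity of $\mathrm{PG}(k-1,q)$, that is $x^\perp=\{y:\beta(x,y)=0\}$. The polarity graph $\mathcal G_q(k,\perp)$ has the points of $\mathrm{PG}(k-1,q)$ as vertices, two distinct points $x,y$ being adjacent if and only if $x\in y^\perp$. Let $T=\{a\in\mathbb F_q: a+a^2+a^4+\dots+a^{2^{h-1}}=1\}$ be the set of elements of absolute trace $1$, and fix $t_0\in T$. For $t\in T$ let $H_t$ be the hyperplane $t_0X_{k-1}+tX_k=0$, and let $H_\infty$ be the hyperplane $X_k=0$. Let $U_i$ be the point represented by the $i$-th standard basis vector, and let $\ell$ be the line $U_{k-2}U_k$ if $k$ is odd and the line $U_{k-1}U_k$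 if $k$ is even. Let $\mathcal H(k,q)$ be the subgraph of $\mathcal G_q(k,\perp)$ induced on the vertex set $\bigcup_{t\in T}H_t\setminus(H_\infty\cup\ell)$. An $(n,d,\lambda)$-graph is a $d$-regular graph on $n$ vertices such that all eigenvalues of its adjacency matrix (counted with multiplicity) except the largest are at most $\lambda$ in absolute value. Then there is an absolute constant $C$ (independent of $q$, $k$ and $t_0$) such that $\mathcal H(k,q)$ is an $(n,d,\lambda)$-graph for some $\lambda\le C\sqrt d$, where \[ (n,d)=\begin{cases}\left(\dfrac{q^{k-1}}2,\dfrac{q^{k-2}}2\right) & \text{if } k \text{ is odd},\\[2ex] \left(\dfrac{q^{k-1}-q}2,\dfrac{q^{k-2}}2\right) & \text{if } k \text{ is even}.\end{cases} \] -/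

import Mathlib

open scoped LinearAlgebra.Projectivization

noncomputable section

open Classical in
/-- `G` is an `(n, d, lam)`-graph: it has `n` vertices, it is `d`-regular, and all eigenvalues of its
adjacency matrix, counted with multiplicity and listed in decreasing order, except the first one
(the largest), are at most `lam` in absolute value. -/
def IsNDLambdaGraph {V : Type*} [Finite V] (G : SimpleGraph V) (n d : ℕ) (lam : ℝ) : Prop :=
  letI := Fintype.ofFinite V
  Fintype.card V = n ∧ G.IsRegularOfDegree d ∧
    ∀ i : Fin (Fintype.card V), 0 < (i : ℕ) →
      |(G.isHermitian_adjMatrix (R := ℝ)).eigenvalues₀ i| ≤ lam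

/-- The set of projective points lying on the projective subspace defined by the linear
subspace `S`. -/
def projPoints {F W : Type*} [Field F] [AddCommGroup W] [Module F W] (S : Submodule F W) :
    Set (ℙ F W) :=
  {p | p.submodule ≤ S}

/-- The image `xᗮ` of the point `x` under the polarity associated with the form `B`. -/
def perpHyperplane {F W : Type*} [Field F] [AddCommGroup W] [Module F W]
    (B : LinearMap.BilinForm F W) (x : ℙ F W) : Set (ℙ F W) :=
  projPoints (B.orthogonal x.submodule)

/-- The polarity graph: two distinct points `x`, `y` are adjacent iff `x` lies on the hyperplane
that the polarity associates with `y`. -/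
def polarityGraph {F W : Type*} [Field F] [AddCommGroup W] [Module F W]
    (B : LinearMap.BilinForm F W) (hB : B.IsSymm) : SimpleGraph (ℙ F W) where
  Adj x y := x ≠ y ∧ x ∈ perpHyperplane B y
  symm := ⟨fun _ _ h => ⟨h.1.symm, fun v hv w hw => by
    have h2 : B v w = 0 := h.2 hw v hv
    exact (hB.eq v w).symm.trans h2⟩⟩
  loopless := ⟨fun _ h => h.1 rfl⟩

namespace PseudoPolarity

variable (F : Type*) [Field F] (k : ℕ)

/-- The coordinate `X_i` on `F ^ k`, with `1`-based index `1 ≤ i ≤ k` (and `0` out of range). -/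
def X (i : ℕ) : (Fin k → F) →ₗ[F] F :=
  if h : 1 ≤ i ∧ i ≤ k then LinearMap.proj ⟨i - 1, by omega⟩ else 0

/-- The vector with one in the (`1`-based) position `i` and zero elsewhere, representing `U_i`. -/
def U (i : ℕ) : Fin k → F := fun j => if (j : ℕ) + 1 = i then 1 else 0

/-- The pseudo-symplectic form
`x₁ y₂ + x₂ y₁ + ⋯ + x_{k-2} y_{k-1} + x_{k-1} y_{k-2} + x_k y_k` for odd `k`, and
`x₁ y₂ + x₂ y₁ + ⋯ + x_{k-1} y_k + x_k y_{k-1} + x_k y_k` for even `k`.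
In both cases there are `⌊k / 2⌋` hyperbolic pairs. -/
def form : LinearMap.BilinForm F (Fin k → F) :=
  ∑ m ∈ Finset.range (k / 2),
      (LinearMap.BilinForm.linMulLin (X F k (2 * m + 1)) (X F k (2 * m + 2)) +
        LinearMap.BilinForm.linMulLin (X F k (2 * m + 2)) (X F k (2 * m + 1))) +
    LinearMap.BilinForm.linMulLin (X F k k) (X F k k)

theorem form_apply (x y : Fin k → F) :
    form F k x y = ∑ m ∈ Finset.range (k / 2),
      (X F k (2 * m + 1) x * X F k (2 * m + 2) y + X F k (2 * m + 2) x * X F k (2 * m + 1) y) +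
        X F k k x * X F k k y := by
  simp [form, LinearMap.sum_apply]

theorem form_isSymm : (form F k).IsSymm :=
  ⟨fun x y => by
    simp only [form_apply]
    refine congrArg₂ _ (Finset.sum_congr rfl fun m _ => ?_) ?_ <;> ring⟩

/-- The set `T` of elements of absolute trace one of the field `F` with `2 ^ h` elements, where
`Tr(a) = a + a ^ 2 + a ^ 4 + ⋯ + a ^ (2 ^ (h - 1))`. -/
def T (h : ℕ) : Set F := {a | ∑ i ∈ Finset.range h, a ^ 2 ^ i = 1}

/-- The hyperplane `H_∞ : X_k = 0`. -/
def HInf : Set (ℙ F (Fin k → F)) := projPoints (LinearMap.ker (X F k k))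

variable {F} in
/-- The hyperplane `H_t : t₀ X_{k-1} + t X_k = 0`. -/
def H (t₀ t : F) : Set (ℙ F (Fin k → F)) :=
  projPoints (LinearMap.ker (t₀ • X F k (k - 1) + t • X F k k))

/-- The line `ℓ`, equal to `U_{k-2} U_k` for odd `k` and to `U_{k-1} U_k` for even `k`. -/
def line : Set (ℙ F (Fin k → F)) :=
  projPoints (Submodule.span F {U F k (if Odd k then k - 2 else k - 1), U F k k})

variable {F} in
/-- The vertex set `⋃_{t ∈ T} H_t ∖ (H_∞ ∪ ℓ)`. -/
def vertexSet (h : ℕ) (t₀ : F) : Set (ℙ F (Fin k → F)) :=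
  (⋃ t ∈ T F h, H k t₀ t) \ (HInf F k ∪ line F k)

variable {F} in
/-- The graph `𝓗(k, q)`, `q = 2 ^ h`: the induced subgraph of the polarity graph of the
pseudo-symplectic polarity on `vertexSet`. -/
def graph (h : ℕ) (t₀ : F) : SimpleGraph (vertexSet k h t₀) :=
  (polarityGraph (form F k) (form_isSymm F k)).induce (vertexSet k h t₀)

end PseudoPolarity

end

/-! Spectral bound: two distinct hyperplanes `yᗮ`, `zᗮ` of `F ^ k` share `q ^ (k - 2)` vectors, so
on functions of sum zero the vector-hyperplane incidence matrix scales norms by a constant. The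
adjacency matrix of an induced subgraph without absolute points is a piece of it, so it contracts
such functions by `√(q ^ (k - 2)) = √2 * √d` (`polarityGraph_induce_sum_sq_le`). For a regular graph
this bounds every eigenvalue but the largest.

Parameters: scale vertices to have `X_k = 1`. The vertex set becomes `t₀ X_{k-1} ∈ T` with `ℓ`
removed, and `β(x,x) = X_k(x)² = 1`, so no vertex is absolute. For a vertex `x`, the functionals
`X_k`, `X_{k-1}`, `β(x,·)` are independent, because `x ∉ ℓ`. As half of the field satisfies `t₀ s ∈
T`, this gives `q ^ (k - 2) / 2` solutions. Deleting `ℓ` loses none of them: a trace computation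
shows that its points are never orthogonal to a vertex (`form_ne_zero_of_mem_lineSubmodule`). -/

/-! ### Eigenvalue bounds from contraction on sum-zero functions. -/

/-- If a real symmetric matrix has constant column sums and contracts the vectors of sum zero by a
factor `lam`, then all its eigenvalues except the largest are at most `lam` in absolute value. -/
theorem Matrix.IsHermitian.abs_eigenvalues₀_le {n : Type*} [Fintype n] [DecidableEq n]
    {A : Matrix n n ℝ} (hA : A.IsHermitian) {d lam : ℝ} (hd0 : 0 ≤ d) (hlam : 0 ≤ lam)
    (hd : ∀ f : n → ℝ, ∑ x, A.mulVec f x = d * ∑ x, f x)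
    (hA2 : ∀ f : n → ℝ, ∑ x, f x = 0 → ∑ x, (A.mulVec f x) ^ 2 ≤ lam ^ 2 * ∑ x, (f x) ^ 2)
    (i : Fin (Fintype.card n)) (hi : 0 < (i : ℕ)) :
    |hA.eigenvalues₀ i| ≤ lam := by
  set e : Fin (Fintype.card n) ≃ n := Fintype.equivOfCardEq (Fintype.card_fin _)
  set i₀ : Fin (Fintype.card n) := ⟨0, hi.trans i.2⟩
  have heig : ∀ k, hA.eigenvalues (e k) = hA.eigenvalues₀ k := fun k => by
    simp [Matrix.IsHermitian.eigenvalues, e]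
  have hmul : ∀ k, ∀ x, A.mulVec (hA.eigenvectorBasis (e k)) x
      = hA.eigenvalues₀ k * hA.eigenvectorBasis (e k) x := fun k x => by
    rw [hA.mulVec_eigenvectorBasis, heig]; simp
  have hle : hA.eigenvalues₀ i ≤ hA.eigenvalues₀ i₀ :=
    hA.eigenvalues₀_antitone (Fin.mk_le_of_le_val (Nat.zero_le _))
  have horth : ∀ a b, ∑ x, hA.eigenvectorBasis (e a) x * hA.eigenvectorBasis (e b) x
      = if a = b then 1 else 0 := fun a b => by
    have := orthonormal_iff_ite.1 hA.eigenvectorBasis.orthonormal (e b) (e a)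
    simp only [PiLp.inner_apply, RCLike.inner_apply, conj_trivial, e.injective.eq_iff] at this
    rw [this]; simp only [eq_comm]
  have hne : i ≠ i₀ := fun h => by simp [h, i₀] at hi
  have huu := horth i i
  have hu₀u₀ := horth i₀ i₀
  have huu₀ := horth i i₀
  rw [if_pos rfl] at huu hu₀u₀
  rw [if_neg hne] at huu₀
  have hmu := hmul i
  have hmu₀ := hmul i₀
  generalize hA.eigenvalues₀ i = μ at *
  generalize hA.eigenvalues₀ i₀ = μ₀ at *
  generalize (hA.eigenvectorBasis (e i)).ofLp = u at *
  generalize (hA.eigenvectorBasis (e i₀)).ofLp = u₀ at *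
  have hsum := hd u
  simp only [hmu, ← Finset.mul_sum] at hsum
  refine abs_le_of_sq_le_sq ?_ hlam
  set s := ∑ x, u x
  set s₀ := ∑ x, u₀ x
  -- If `s ≠ 0` then `μ = d`, and `s₀ u - s u₀` has sum zero. Contraction applied to it, with `0 ≤ μ
  -- ≤ μ₀`, bounds `μ`; this covers a repeated eigenvalue `d`.
  by_cases hs : s = 0
  · have := hA2 u hs
    simp only [hmu, mul_pow, ← Finset.mul_sum] at this
    simpa only [pow_two, huu, mul_one] using this
  · obtain rfl : μ = d := mul_right_cancel₀ hs hsum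
    have hw : ∑ x, (s₀ • u - s • u₀) x = 0 := by
      simp only [Pi.sub_apply, Pi.smul_apply, smul_eq_mul, Finset.sum_sub_distrib,
        ← Finset.mul_sum]
      ring
    have hexp : ∀ a b : ℝ, ∑ x, (a * u x - b * u₀ x) ^ 2 = a ^ 2 + b ^ 2 := fun a b => by
      calc ∑ x, (a * u x - b * u₀ x) ^ 2
          = ∑ x, (a ^ 2 * (u x * u x) - 2 * a * b * (u x * u₀ x) + b ^ 2 * (u₀ x * u₀ x)) :=
            Finset.sum_congr rfl fun x _ => by ring
        _ = a ^ 2 + b ^ 2 := by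
            rw [Finset.sum_add_distrib, Finset.sum_sub_distrib, ← Finset.mul_sum, ← Finset.mul_sum,
              ← Finset.mul_sum, huu, hu₀u₀, huu₀]
            ring
    have := hA2 _ hw
    simp only [Matrix.mulVec_sub, Matrix.mulVec_smul, Pi.sub_apply, Pi.smul_apply, smul_eq_mul,
      hmu, hmu₀, ← mul_assoc, hexp] at this
    have hs2 : 0 < s ^ 2 := by positivity
    have h2 : μ ^ 2 ≤ μ₀ ^ 2 := pow_le_pow_left₀ hd0 hle 2
    have h3 : s ^ 2 * μ ^ 2 ≤ s ^ 2 * μ₀ ^ 2 := mul_le_mul_of_nonneg_left h2 hs2.le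
    refine le_of_mul_le_mul_right ?_ (add_pos_of_nonneg_of_pos (sq_nonneg s₀) hs2)
    nlinarith

open Classical in
theorem IsNDLambdaGraph.of_sum_sq_le {V : Type*} [hV : Fintype V] {G : SimpleGraph V} {n d : ℕ}
    {lam : ℝ} (hn : Nat.card V = n) (hd : ∀ x, (G.neighborSet x).ncard = d) (hlam : 0 ≤ lam)
    (h : ∀ f : V → ℝ, ∑ x, f x = 0 →
      ∑ x, (∑ y with G.Adj x y, f y) ^ 2 ≤ lam ^ 2 * ∑ x, (f x) ^ 2) :
    IsNDLambdaGraph G n d lam := by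
  have hreg : ∀ [Fintype V], G.IsRegularOfDegree d := fun {_} x => by
    rw [← hd x, ← SimpleGraph.card_neighborSet_eq_degree, Set.ncard_eq_toFinset_card',
      Set.toFinset_card]
  unfold IsNDLambdaGraph
  -- The `Fintype` instance chosen inside the definition is identified with the ambient one.
  generalize Fintype.ofFinite V = inst
  obtain rfl := Subsingleton.elim inst hV
  refine ⟨by rw [← hn, Nat.card_eq_fintype_card], hreg, ?_⟩
  have hm : ∀ (f : V → ℝ) x, (G.adjMatrix ℝ).mulVec f x = ∑ y with G.Adj x y, f y := fun f x => by
    rw [SimpleGraph.adjMatrix_mulVec_apply, SimpleGraph.neighborFinset_eq_filter]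
  refine Matrix.IsHermitian.abs_eigenvalues₀_le _ d.cast_nonneg hlam (fun f => ?_) fun f hf => ?_
  · simp only [hm, Finset.sum_filter]
    rw [Finset.sum_comm, Finset.mul_sum]
    refine Finset.sum_congr rfl fun y _ => ?_
    rw [← Finset.sum_filter, Finset.sum_const, nsmul_eq_mul]
    congr 2
    rw [← hreg y, ← SimpleGraph.card_neighborFinset_eq_degree,
      SimpleGraph.neighborFinset_eq_filter]
    simp only [SimpleGraph.adj_comm]
  · simpa only [hm] using h f hf

/-! ### Expansion of polarity graphs. -/

section PolarityExpansion

variable {F W : Type*} [Field F] [AddCommGroup W] [Module F W]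

theorem LinearMap.BilinForm.mem_orthogonal_sup {B : LinearMap.BilinForm F W} {S S' : Submodule F W}
    {v : W} : v ∈ B.orthogonal (S ⊔ S') ↔ v ∈ B.orthogonal S ∧ v ∈ B.orthogonal S' := by
  refine ⟨fun h => ⟨fun w hw => h w (Submodule.mem_sup_left hw),
    fun w hw => h w (Submodule.mem_sup_right hw)⟩, fun h w hw => ?_⟩
  obtain ⟨a, ha, b, hb, rfl⟩ := Submodule.mem_sup.1 hw
  have h1 : B a v = 0 := h.1 a ha
  have h2 : B b v = 0 := h.2 b hb
  change B (a + b) v = 0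
  rw [map_add, LinearMap.add_apply, h1, h2, add_zero]

theorem Projectivization.finrank_submodule_sup_of_ne {x y : ℙ F W} (hxy : x ≠ y) :
    Module.finrank F (x.submodule ⊔ y.submodule : Submodule F W) = 2 := by
  have := (Projectivization.linearIndependent_pair_iff_ne.2 hxy)
  have h2 := finrank_span_eq_card this
  rw [Matrix.range_cons, Matrix.range_cons, Matrix.range_empty, Set.union_empty,
    Submodule.span_union, ← Projectivization.submodule_eq, ← Projectivization.submodule_eq] at h2
  simpa using h2

open Classical in
theorem card_orthogonal_inter [Fintype F] [Fintype W] {B : LinearMap.BilinForm F W}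
    (hB : B.Nondegenerate) (x y : ℙ F W) :
    Fintype.card {v : W // v ∈ B.orthogonal x.submodule ∧ v ∈ B.orthogonal y.submodule}
      = Fintype.card F ^ (Module.finrank F W - if x = y then 1 else 2) := by
  have : Fintype.card (B.orthogonal (x.submodule ⊔ y.submodule))
      = Fintype.card F ^ (Module.finrank F W - if x = y then 1 else 2) := by
    rw [Module.card_eq_pow_finrank (K := F), LinearMap.BilinForm.finrank_orthogonal hB]
    split_ifs with h
    · rw [h, sup_idem, y.finrank_submodule]
    · rw [Projectivization.finrank_submodule_sup_of_ne h]
  rw [← this]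
  exact Fintype.card_congr (Equiv.subtypeEquivRight fun v =>
    LinearMap.BilinForm.mem_orthogonal_sup.symm)

open Classical in
/-- The incidence matrix between vectors and hyperplanes `yᗮ` acts as a multiple of an isometry on
functions of sum zero. -/
theorem sum_sq_sum_orthogonal [Fintype F] [Fintype W] {B : LinearMap.BilinForm F W}
    (hB : B.Nondegenerate) (hW : 2 ≤ Module.finrank F W) (P : Set (ℙ F W)) [Fintype P]
    (f : P → ℝ) (hf : ∑ y, f y = 0) :
    ∑ v : W, (∑ y : P with v ∈ B.orthogonal y.1.submodule, f y) ^ 2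
      = ((Fintype.card F : ℝ) - 1) * ((Fintype.card F : ℝ) ^ (Module.finrank F W - 2)
          * ∑ y, (f y) ^ 2) := by
  set q := (Fintype.card F : ℝ)
  set k := Module.finrank F W
  -- The `q ^ (k - 2)` common to all pairs contributes a multiple of `(∑ f)² = 0`; only the diagonal
  -- excess survives.
  have hcount : ∀ y z : P, ∑ v : W, (if v ∈ B.orthogonal y.1.submodule then (1 : ℝ) else 0)
      * (if v ∈ B.orthogonal z.1.submodule then 1 else 0)
      = q ^ (k - 2) + if y = z then (q - 1) * q ^ (k - 2) else 0 := fun y z => by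
    simp only [← ite_and, mul_ite, mul_one, mul_zero]
    rw [Finset.sum_boole, ← Fintype.card_subtype]
    have : ∀ v : W, (v ∈ B.orthogonal z.1.submodule ∧ v ∈ B.orthogonal y.1.submodule) ↔
      (v ∈ B.orthogonal y.1.submodule ∧ v ∈ B.orthogonal z.1.submodule) := fun v => and_comm
    simp only [this]
    rw [card_orthogonal_inter hB]
    simp only [Subtype.ext_iff]
    push_cast
    change q ^ (k - _) = _
    split_ifs
    · rw [show k - 1 = (k - 2) + 1 by omega, pow_succ]; ring
    · ring
  calc ∑ v : W, (∑ y : P with v ∈ B.orthogonal y.1.submodule, f y) ^ 2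
      = ∑ v : W, ∑ y : P, ∑ z : P, f y * f z *
          ((if v ∈ B.orthogonal y.1.submodule then (1 : ℝ) else 0)
            * (if v ∈ B.orthogonal z.1.submodule then 1 else 0)) := by
        refine Finset.sum_congr rfl fun v _ => ?_
        rw [Finset.sum_filter, pow_two, Finset.sum_mul_sum]
        refine Finset.sum_congr rfl fun y _ => Finset.sum_congr rfl fun z _ => ?_
        split_ifs <;> simp
    _ = ∑ y : P, ∑ z : P, f y * f z *
          (q ^ (k - 2) + if y = z then (q - 1) * q ^ (k - 2) else 0) := by
        rw [Finset.sum_comm]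
        refine Finset.sum_congr rfl fun y _ => ?_
        rw [Finset.sum_comm]
        refine Finset.sum_congr rfl fun z _ => ?_
        rw [← Finset.mul_sum, hcount]
    _ = (∑ y : P, f y) * (∑ z : P, f z) * q ^ (k - 2)
          + ∑ y : P, f y * f y * ((q - 1) * q ^ (k - 2)) := by
        rw [Finset.sum_mul_sum]
        simp only [mul_add, Finset.sum_add_distrib, mul_ite, mul_zero, Finset.sum_ite_eq,
          Finset.mem_univ, if_true, Finset.sum_mul]
    _ = _ := by
        rw [hf, zero_mul, zero_mul, zero_add, ← Finset.sum_mul]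
        simp only [pow_two]
        ring

open Classical in
/-- Any induced subgraph of a polarity graph on non-absolute points contracts functions of
sum zero. -/
theorem polarityGraph_induce_sum_sq_le [Fintype F] [Fintype W] {B : LinearMap.BilinForm F W}
    (hBs : B.IsSymm) (hB : B.Nondegenerate) (hW : 2 ≤ Module.finrank F W) (P : Set (ℙ F W))
    [Fintype P] (hP : ∀ x ∈ P, x ∉ perpHyperplane B x) (f : P → ℝ) (hf : ∑ y, f y = 0) :
    ∑ x, (∑ y with ((polarityGraph B hBs).induce P).Adj x y, f y) ^ 2
      ≤ (Fintype.card F : ℝ) ^ (Module.finrank F W - 2) * ∑ y, (f y) ^ 2 := by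
  have hq : (0 : ℝ) < (Fintype.card F : ℝ) - 1 := by
    have : 1 < Fintype.card F := Fintype.one_lt_card
    have : (1 : ℝ) < Fintype.card F := by exact_mod_cast this
    linarith
  -- Without absolute points the condition `x ≠ y` is automatic, so adjacency is plain
  -- orthogonality.
  have hadj : ∀ (c : Fˣ) (x y : P), ((polarityGraph B hBs).induce P).Adj x y ↔
      (c : F) • x.1.rep ∈ B.orthogonal y.1.submodule := fun c x y => by
    rw [Submodule.smul_mem_iff _ c.ne_zero, ← Submodule.span_singleton_le_iff_mem,
      ← Projectivization.submodule_eq]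
    refine ⟨fun h => h.2, fun h => ⟨?_, h⟩⟩
    rintro h'
    change x.1 = y.1 at h'
    exact hP x x.2 (by rw [← h'] at h; exact h)
  -- Each vertex accounts for `q - 1` distinct vectors, so `q - 1` times the graph sum is part of
  -- the sum over all vectors.
  have hinj : Function.Injective fun p : Fˣ × P => (p.1 : F) • p.2.1.rep := by
    rintro ⟨c, x⟩ ⟨c', x'⟩ h
    simp only at h
    have hx : x = x' := by
      rw [Subtype.ext_iff, ← x.1.mk_rep, ← x'.1.mk_rep, Projectivization.mk_eq_mk_iff']
      refine ⟨(c : F)⁻¹ * c', ?_⟩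
      rw [mul_smul, ← h, inv_smul_smul₀ c.ne_zero]
    subst hx
    have := smul_left_injective F x.1.rep_nonzero h
    rw [Units.ext this]
  refine le_of_mul_le_mul_left ?_ hq
  rw [← sum_sq_sum_orthogonal hB hW P f hf]
  calc ((Fintype.card F : ℝ) - 1) *
        ∑ x, (∑ y with ((polarityGraph B hBs).induce P).Adj x y, f y) ^ 2
      = ∑ p : Fˣ × P, (∑ y : P with (p.1 : F) • p.2.1.rep ∈ B.orthogonal y.1.submodule, f y) ^ 2 :=
        by
        simp only [Fintype.sum_prod_type, ← hadj]
        rw [Finset.sum_const, Finset.card_univ, Fintype.card_units, nsmul_eq_mul,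
          Nat.cast_sub Fintype.card_pos, Nat.cast_one]
    _ = ∑ v ∈ Finset.univ.map ⟨_, hinj⟩,
          (∑ y : P with v ∈ B.orthogonal y.1.submodule, f y) ^ 2 := by
        rw [Finset.sum_map]; rfl
    _ ≤ _ := Finset.sum_le_sum_of_subset_of_nonneg (Finset.subset_univ _) fun _ _ _ => sq_nonneg _

end PolarityExpansion

/-- A preimage under a surjective linear map is equivalent to the product with the kernel. -/
noncomputable def LinearMap.preimageEquivProdKer {R V W : Type*} [Ring R] [AddCommGroup V]
    [AddCommGroup W] [Module R V] [Module R W] (φ : V →ₗ[R] W) (hφ : Function.Surjective φ)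
    (S : Set W) : (φ ⁻¹' S) ≃ S × LinearMap.ker φ where
  toFun v := (⟨φ v.1, v.2⟩, ⟨v.1 - Function.surjInv hφ (φ v.1), by
    simp [Function.surjInv_eq hφ]⟩)
  invFun p := ⟨p.2.1 + Function.surjInv hφ p.1.1, by
    rw [Set.mem_preimage, map_add, p.2.2, Function.surjInv_eq hφ, zero_add]; exact p.1.2⟩
  left_inv v := by simp
  right_inv p := by
    have h : φ (p.2.1 + Function.surjInv hφ p.1.1) = p.1.1 := by
      rw [map_add, p.2.2, Function.surjInv_eq hφ, zero_add]
    ext <;> simp [Function.surjInv_eq hφ]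

/-- All fibres are cosets of the kernel; the product form avoids division. -/
theorem LinearMap.ncard_preimage_mul_card {R V W : Type*} [Ring R] [AddCommGroup V]
    [AddCommGroup W] [Module R V] [Module R W] (φ : V →ₗ[R] W) (hφ : Function.Surjective φ)
    (S : Set W) : (φ ⁻¹' S).ncard * Nat.card W = S.ncard * Nat.card V := by
  have h1 := Nat.card_congr (φ.preimageEquivProdKer hφ S)
  have h2 := Nat.card_congr (φ.preimageEquivProdKer hφ Set.univ)
  rw [Nat.card_prod] at h1 h2
  rw [Nat.card_coe_set_eq, Nat.card_coe_set_eq] at h1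
  rw [Set.preimage_univ, Nat.card_univ, Nat.card_univ] at h2
  rw [h1, h2]
  ring

namespace PseudoPolarity

/-! ### The absolute trace. -/

section Trace

variable {F : Type*} [Field F] {h : ℕ}

theorem sum_pow_two_pow_add [CharP F 2] (a b : F) :
    ∑ i ∈ Finset.range h, (a + b) ^ 2 ^ i
      = ∑ i ∈ Finset.range h, a ^ 2 ^ i + ∑ i ∈ Finset.range h, b ^ 2 ^ i := by
  simp only [add_pow_char_pow, Finset.sum_add_distrib]

theorem sum_pow_two_pow_eq_zero_or_one [Fintype F] [CharP F 2] (hF : Fintype.card F = 2 ^ h)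
    (a : F) : ∑ i ∈ Finset.range h, a ^ 2 ^ i = 0 ∨ ∑ i ∈ Finset.range h, a ^ 2 ^ i = 1 := by
  set s := ∑ i ∈ Finset.range h, a ^ 2 ^ i with hs
  have h1 : s ^ 2 = s := by
    rw [hs, sum_pow_char]
    simp only [← pow_mul, ← pow_succ]
    -- Squaring shifts the summands cyclically, since `a ^ 2 ^ h = a`.
    have h2 := Finset.sum_range_succ (fun i => a ^ 2 ^ i) h
    rw [Finset.sum_range_succ', ← hF, FiniteField.pow_card, pow_zero, pow_one] at h2
    exact add_right_cancel h2
  have h3 : s * (s - 1) = 0 := by linear_combination h1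
  rcases mul_eq_zero.1 h3 with h4 | h4
  · exact .inl h4
  · exact .inr (sub_eq_zero.1 h4)

theorem zero_notMem_T : (0 : F) ∉ T F h := by
  simp [T]

theorem add_mem_T_iff [Fintype F] [CharP F 2] (hF : Fintype.card F = 2 ^ h) {t : F}
    (ht : t ∈ T F h) (a : F) : a + t ∈ T F h ↔ a ∉ T F h := by
  have ht' : ∑ i ∈ Finset.range h, t ^ 2 ^ i = 1 := ht
  simp only [T, Set.mem_ofPred_eq, sum_pow_two_pow_add, ht']
  rcases sum_pow_two_pow_eq_zero_or_one hF a with h0 | h0 <;> rw [h0]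
  · simp
  · simp [CharTwo.add_self_eq_zero]

theorem two_mul_ncard_mul_mem_T [Fintype F] [CharP F 2] (hF : Fintype.card F = 2 ^ h) {t : F}
    (ht : t ∈ T F h) : 2 * {s : F | t * s ∈ T F h}.ncard = Fintype.card F := by
  have h0 : t ≠ 0 := fun h0 => zero_notMem_T (h0 ▸ ht)
  -- The shift `s ↦ s + 1` adds `t`, of trace one, to `t * s`, so it swaps the set with its
  -- complement.
  have hc : {s : F | t * s ∈ T F h}ᶜ.ncard = {s : F | t * s ∈ T F h}.ncard := by
    rw [← Set.ncard_image_of_injective {s : F | t * s ∈ T F h} (add_left_injective (1 : F))]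
    congr 1
    ext s
    have := add_mem_T_iff hF ht (t * (s + 1))
    simp only [Set.mem_compl_iff, Set.mem_ofPred_eq, Set.image_add_right, Set.mem_preimage]
    rw [CharTwo.neg_eq, ← not_iff_comm.1 this.symm]
    rw [mul_add, mul_one, add_assoc, CharTwo.add_self_eq_zero, add_zero]
  have := Set.ncard_add_ncard_compl {s : F | t * s ∈ T F h}
  rw [hc, Nat.card_eq_fintype_card] at this
  omega

end Trace

/-! ### Coordinates and nondegeneracy of the form. -/

section Coordinates

variable {F : Type*} [Field F] {k : ℕ}

theorem X_apply {i : ℕ} (h1 : 1 ≤ i) (h2 : i ≤ k) (x : Fin k → F) :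
    X F k i x = x ⟨i - 1, by omega⟩ := by
  simp [X, h1, h2]

theorem X_U {i : ℕ} (h1 : 1 ≤ i) (h2 : i ≤ k) (j : ℕ) :
    X F k i (U F k j) = if i = j then 1 else 0 := by
  rw [X_apply h1 h2, U]
  simp only [Nat.sub_add_cancel h1]

theorem ext_X {x y : Fin k → F} (hxy : ∀ i, 1 ≤ i → i ≤ k → X F k i x = X F k i y) : x = y := by
  funext j
  have := hxy (j + 1) (by omega) (by omega)
  rwa [X_apply (by omega) (by omega), X_apply (by omega) (by omega)] at this

theorem form_U_odd {m : ℕ} (hm : m < k / 2) (x : Fin k → F) :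
    form F k x (U F k (2 * m + 1))
      = X F k (2 * m + 2) x + X F k k x * X F k k (U F k (2 * m + 1)) := by
  rw [form_apply, Finset.sum_eq_single m]
  · rw [X_U (by omega) (by omega), X_U (by omega) (by omega)]
    simp
  · intro n hn hnm
    have := Finset.mem_range.1 hn
    rw [X_U (by omega) (by omega), X_U (by omega) (by omega), if_neg (by omega),
      if_neg (by omega)]
    simp
  · intro h; exact absurd (Finset.mem_range.2 hm) h

theorem form_U_even {m : ℕ} (hm : m < k / 2) (x : Fin k → F) :
    form F k x (U F k (2 * m + 2))
      = X F k (2 * m + 1) x + X F k k x * X F k k (U F k (2 * m + 2)) := by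
  rw [form_apply, Finset.sum_eq_single m]
  · rw [X_U (by omega) (by omega), X_U (by omega) (by omega)]
    simp
  · intro n hn hnm
    have := Finset.mem_range.1 hn
    rw [X_U (by omega) (by omega), X_U (by omega) (by omega), if_neg (by omega),
      if_neg (by omega)]
    simp
  · intro h; exact absurd (Finset.mem_range.2 hm) h

theorem form_U_self_of_odd (hk : Odd k) (x : Fin k → F) : form F k x (U F k k) = X F k k x := by
  obtain ⟨n, hn⟩ := hk
  rw [form_apply, Finset.sum_eq_zero, X_U (by omega) le_rfl]
  · simp
  · intro m hm
    have := Finset.mem_range.1 hm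
    rw [X_U (by omega) (by omega), X_U (by omega) (by omega), if_neg (by omega),
      if_neg (by omega)]
    simp

theorem form_self [CharP F 2] (x : Fin k → F) : form F k x x = X F k k x * X F k k x := by
  rw [form_apply, Finset.sum_eq_zero, zero_add]
  intro m _
  rw [mul_comm (X F k (2 * m + 2) x), CharTwo.add_self_eq_zero]

theorem eq_zero_of_form_eq_zero (hk : 2 ≤ k) {x : Fin k → F} (hx : ∀ y, form F k x y = 0) :
    x = 0 := by
  -- `X_k` comes first: it is the correction term when other coordinates are read off by pairing
  -- with basis vectors.
  have hxk : X F k k x = 0 := by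
    rcases Nat.even_or_odd k with he | ho
    · obtain ⟨n, hn⟩ := he
      have := hx (U F k (2 * (n - 1) + 1))
      rw [form_U_odd (by omega), X_U (by omega) le_rfl, if_neg (by omega), mul_zero,
        add_zero] at this
      convert this using 3
      omega
    · rw [← form_U_self_of_odd ho, hx]
  refine ext_X fun i h1 h2 => ?_
  rw [map_zero]
  rcases Nat.even_or_odd i with he | ho
  · obtain ⟨n, hn⟩ := he
    have := hx (U F k (2 * (n - 1) + 1))
    rw [form_U_odd (by omega), hxk, zero_mul, add_zero] at this
    convert this using 3
    omega
  · obtain ⟨n, hn⟩ := ho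
    by_cases hik : i = k
    · rw [hik, hxk]
    · have := hx (U F k (2 * n + 2))
      rw [form_U_even (by omega), hxk, zero_mul, add_zero] at this
      rw [hn, this]

theorem form_nondegenerate (hk : 2 ≤ k) : (form F k).Nondegenerate :=
  ⟨fun _ hx => eq_zero_of_form_eq_zero hk hx, fun _ hx => eq_zero_of_form_eq_zero hk fun y =>
    ((form_isSymm F k).eq _ _).symm.trans (hx y)⟩

end Coordinates

/-! ### Affine representatives with last coordinate one. -/

section Normalization

variable {F : Type*} [Field F] {k : ℕ}

theorem mem_projPoints_iff {W : Type*} [AddCommGroup W] [Module F W] {S : Submodule F W}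
    {p : ℙ F W} : p ∈ projPoints S ↔ p.rep ∈ S := by
  rw [projPoints, Set.mem_ofPred_eq, Projectivization.submodule_eq,
    Submodule.span_singleton_le_iff_mem]

variable (F k) in
/-- The representative of a point off `H_∞` whose last coordinate is one. -/
noncomputable def affineRep (p : ℙ F (Fin k → F)) : Fin k → F := (X F k k p.rep)⁻¹ • p.rep

theorem X_rep_ne_zero {p : ℙ F (Fin k → F)} (hp : p ∉ HInf F k) : X F k k p.rep ≠ 0 := fun h =>
  hp (mem_projPoints_iff.2 h)

theorem X_affineRep {p : ℙ F (Fin k → F)} (hp : p ∉ HInf F k) :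
    X F k k (affineRep F k p) = 1 := by
  rw [affineRep, map_smul, smul_eq_mul, inv_mul_cancel₀ (X_rep_ne_zero hp)]

theorem affineRep_mem_iff {p : ℙ F (Fin k → F)} (hp : p ∉ HInf F k)
    {S : Submodule F (Fin k → F)} : affineRep F k p ∈ S ↔ p ∈ projPoints S := by
  rw [affineRep, Submodule.smul_mem_iff _ (inv_ne_zero (X_rep_ne_zero hp)), mem_projPoints_iff]

theorem mem_perpHyperplane_iff {x y : ℙ F (Fin k → F)} (hx : x ∉ HInf F k) (hy : y ∉ HInf F k) :
    x ∈ perpHyperplane (form F k) y ↔ form F k (affineRep F k y) (affineRep F k x) = 0 := by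
  rw [perpHyperplane, ← affineRep_mem_iff hx, Projectivization.submodule_eq,
    LinearMap.BilinForm.mem_orthogonal_iff]
  refine ⟨fun h => h _ (Submodule.smul_mem _ _ (Submodule.mem_span_singleton_self _)),
    fun h v hv => ?_⟩
  obtain ⟨c, rfl⟩ := Submodule.mem_span_singleton.1 hv
  rw [affineRep, map_smul, LinearMap.smul_apply, smul_eq_mul] at h
  have := (mul_eq_zero.1 h).resolve_left (inv_ne_zero (X_rep_ne_zero hy))
  change form F k (c • y.rep) _ = 0
  rw [map_smul, LinearMap.smul_apply, this, smul_zero]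

theorem bijOn_affineRep :
    Set.BijOn (affineRep F k) {p | p ∉ HInf F k} {z | X F k k z = 1} := by
  refine ⟨fun p hp => X_affineRep hp, fun p hp p' hp' h => ?_, fun z hz => ?_⟩
  · rw [← p.mk_rep, ← p'.mk_rep, Projectivization.mk_eq_mk_iff']
    refine ⟨X F k k p.rep * (X F k k p'.rep)⁻¹, ?_⟩
    rw [mul_smul]
    change _ • affineRep F k p' = _
    rw [← h, affineRep, smul_inv_smul₀ (X_rep_ne_zero hp)]
  · have hz' : X F k k z = 1 := hz
    have hz0 : z ≠ 0 := fun h0 => by simp [h0] at hz'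
    obtain ⟨a, ha⟩ := Projectivization.exists_smul_eq_mk_rep F z hz0
    have hX : X F k k (Projectivization.mk F z hz0).rep = a := by
      rw [← ha, Units.smul_def, map_smul, hz', smul_eq_mul, mul_one]
    refine ⟨Projectivization.mk F z hz0, fun h => ?_, ?_⟩
    · exact a.ne_zero (hX ▸ mem_projPoints_iff.1 h)
    · rw [affineRep, hX, ← ha, Units.smul_def, inv_smul_smul₀ a.ne_zero]

end Normalization

end PseudoPolarity

namespace PseudoPolarity

/-! ### Counting vertices and neighbours. -/

section Counting

variable {F : Type*} [Field F] {k h : ℕ} {t₀ : F}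

variable (F k) in
/-- The linear subspace defining the line `ℓ`. -/
noncomputable def lineSubmodule : Submodule F (Fin k → F) :=
  Submodule.span F {U F k (if Odd k then k - 2 else k - 1), U F k k}

variable (k h t₀) in
/-- The vectors with last coordinate one on the hyperplanes `H_t`, `t ∈ T`. -/
def affineSet : Set (Fin k → F) := {z | X F k k z = 1 ∧ t₀ * X F k (k - 1) z ∈ T F h}

theorem mem_vertexSet_iff [CharP F 2] {p : ℙ F (Fin k → F)} :
    p ∈ vertexSet k h t₀ ↔
      p ∉ HInf F k ∧ affineRep F k p ∈ affineSet k h t₀ \ (lineSubmodule F k : Set _) := by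
  rw [vertexSet, Set.mem_sdiff, Set.mem_union, not_or, Set.mem_iUnion₂, Set.mem_sdiff]
  by_cases hp : p ∈ HInf F k
  · simp [hp]
  have hH : ∀ t, p ∈ H k t₀ t ↔ t₀ * X F k (k - 1) (affineRep F k p) = t := fun t => by
    rw [H, ← affineRep_mem_iff hp, LinearMap.mem_ker, LinearMap.add_apply, LinearMap.smul_apply,
      LinearMap.smul_apply, X_affineRep hp, smul_eq_mul, smul_eq_mul, mul_one,
      CharTwo.add_eq_zero]
  have hL : p ∈ line F k ↔ affineRep F k p ∈ (lineSubmodule F k : Set _) :=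
    (affineRep_mem_iff hp).symm
  simp only [hH, hL, hp, not_false_eq_true, true_and, exists_prop, affineSet, Set.mem_ofPred_eq,
    X_affineRep hp, exists_eq_right']

theorem bijOn_affineRep_vertexSet [CharP F 2] :
    Set.BijOn (affineRep F k) (vertexSet k h t₀)
      (affineSet k h t₀ \ (lineSubmodule F k : Set _)) := by
  have hb := bijOn_affineRep (F := F) (k := k)
  refine ⟨fun p hp => (mem_vertexSet_iff.1 hp).2,
    hb.injOn.mono fun p hp => (mem_vertexSet_iff.1 hp).1, fun z hz => ?_⟩
  obtain ⟨p, hp, rfl⟩ := hb.surjOn (show z ∈ {z | X F k k z = 1} from hz.1.1)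
  exact ⟨p, mem_vertexSet_iff.2 ⟨hp, hz⟩, rfl⟩

theorem X_ne_zero_of_mem_affineSet {z : Fin k → F} (hz : z ∈ affineSet k h t₀) :
    X F k (k - 1) z ≠ 0 := fun h0 => zero_notMem_T (F := F) (h := h) (by
  have := hz.2
  rwa [h0, mul_zero] at this)

theorem disjoint_affineSet_lineSubmodule (hk : 3 ≤ k) (ho : Odd k) :
    Disjoint (affineSet k h t₀) (lineSubmodule F k : Set _) := by
  rw [Set.disjoint_left]
  intro z hz hzL
  rw [SetLike.mem_coe, lineSubmodule, if_pos ho, Submodule.mem_span_pair] at hzL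
  obtain ⟨a, b, rfl⟩ := hzL
  refine X_ne_zero_of_mem_affineSet hz ?_
  rw [map_add, map_smul, map_smul, X_U (by omega) (by omega), X_U (by omega) (by omega),
    if_neg (by omega), if_neg (by omega), smul_zero, smul_zero, add_zero]

theorem mem_lineSubmodule_iff (hk : 3 ≤ k) (he : Even k) {z : Fin k → F} (hz : X F k k z = 1) :
    z ∈ lineSubmodule F k ↔ z = X F k (k - 1) z • U F k (k - 1) + U F k k := by
  rw [lineSubmodule, if_neg (Nat.not_odd_iff_even.2 he), Submodule.mem_span_pair]
  refine ⟨?_, fun h => ⟨X F k (k - 1) z, 1, by rw [one_smul]; exact h.symm⟩⟩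
  rintro ⟨a, b, rfl⟩
  rw [map_add, map_smul, map_smul, X_U (by omega) le_rfl, X_U (by omega) le_rfl,
    if_neg (by omega), if_pos rfl, smul_zero, zero_add, smul_eq_mul, mul_one] at hz
  rw [map_add, map_smul, map_smul, X_U (by omega) (by omega), X_U (by omega) (by omega),
    if_pos rfl, if_neg (by omega), smul_zero, add_zero, smul_eq_mul, mul_one, hz, one_smul]

theorem ncard_affineSet_inter_lineSubmodule (hk : 3 ≤ k) (he : Even k) :
    (affineSet k h t₀ ∩ (lineSubmodule F k : Set _)).ncard = {s : F | t₀ * s ∈ T F h}.ncard := by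
  have hX : ∀ s : F, X F k k (s • U F k (k - 1) + U F k k) = 1 := fun s => by
    rw [map_add, map_smul, X_U (by omega) le_rfl, X_U (by omega) le_rfl, if_neg (by omega),
      if_pos rfl, smul_zero, zero_add]
  have hX' : ∀ s : F, X F k (k - 1) (s • U F k (k - 1) + U F k k) = s := fun s => by
    rw [map_add, map_smul, X_U (by omega) (by omega), X_U (by omega) (by omega), if_pos rfl,
      if_neg (by omega), smul_eq_mul, mul_one, add_zero]
  rw [← Set.ncard_image_of_injective {s : F | t₀ * s ∈ T F h}
    (f := fun s => s • U F k (k - 1) + U F k k)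
    (Function.LeftInverse.injective (g := X F k (k - 1)) hX')]
  congr 1
  ext z
  constructor
  · rintro ⟨hz, hzL⟩
    exact ⟨X F k (k - 1) z, hz.2, ((mem_lineSubmodule_iff hk he hz.1).1 hzL).symm⟩
  · rintro ⟨s, hs, rfl⟩
    refine ⟨⟨hX s, ?_⟩, (mem_lineSubmodule_iff hk he (hX s)).2 (by simp only [hX'])⟩
    simp only [hX']
    exact hs

theorem two_mul_ncard_affineSet [Fintype F] [CharP F 2] (hF : Fintype.card F = 2 ^ h)
    (ht : t₀ ∈ T F h) (hk : 3 ≤ k) :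
    2 * (affineSet k h t₀).ncard = Fintype.card F ^ (k - 1) := by
  have hsurj : Function.Surjective ((X F k k).prod (X F k (k - 1))) := fun p => by
    refine ⟨p.1 • U F k k + p.2 • U F k (k - 1), Prod.ext ?_ ?_⟩
    · change X F k k _ = p.1
      rw [map_add, map_smul, map_smul, X_U (by omega) le_rfl, X_U (by omega) le_rfl, if_pos rfl, if_neg (by omega)]
      simp
    · change X F k (k - 1) _ = p.2
      rw [map_add, map_smul, map_smul, X_U (by omega) (by omega), X_U (by omega) (by omega), if_neg (by omega), if_pos rfl]
      simp
  have hpre : affineSet k h t₀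
      = (X F k k).prod (X F k (k - 1)) ⁻¹' ({1} ×ˢ {s : F | t₀ * s ∈ T F h}) := rfl
  have hcard := LinearMap.ncard_preimage_mul_card _ hsurj ({1} ×ˢ {s : F | t₀ * s ∈ T F h})
  have hT := two_mul_ncard_mul_mem_T hF ht
  rw [← hpre, Set.ncard_prod, Set.ncard_singleton, one_mul, Nat.card_prod,
    Nat.card_eq_fintype_card, Nat.card_eq_fintype_card, Fintype.card_fun, Fintype.card_fin] at hcard
  have hq : 0 < Fintype.card F * Fintype.card F := Nat.mul_pos Fintype.card_pos Fintype.card_pos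
  refine Nat.eq_of_mul_eq_mul_right hq ?_
  rw [mul_assoc, hcard, ← mul_assoc, hT, ← mul_assoc, ← pow_succ, Nat.sub_add_cancel (by omega),
    mul_comm]

/-- Supplies the independence of `β(x,·)` from `X_k` and `X_{k-1}`. For even `k`, if every `U_j`
with `j ≤ k - 2` failed, `x` would lie on `ℓ`; for odd `k`, pairing with `U_{k-2}` gives `X_{k-1}(x)
≠ 0`. -/
theorem exists_form_ne_zero (hk : 3 ≤ k) {x : Fin k → F}
    (hx : x ∈ affineSet k h t₀ \ (lineSubmodule F k : Set _)) :
    ∃ w, X F k k w = 0 ∧ X F k (k - 1) w = 0 ∧ form F k x w ≠ 0 := by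
  suffices ∃ j, 1 ≤ j ∧ j ≤ k - 2 ∧ form F k x (U F k j) ≠ 0 by
    obtain ⟨j, h1, h2, h3⟩ := this
    exact ⟨U F k j, by rw [X_U (by omega) le_rfl, if_neg (by omega)],
      by rw [X_U (by omega) (by omega), if_neg (by omega)], h3⟩
  rcases Nat.even_or_odd k with he | ho
  · by_contra! hcon
    refine hx.2 ((mem_lineSubmodule_iff hk he hx.1.1).2 (ext_X fun i h1 h2 => ?_))
    rw [map_add, map_smul, X_U h1 h2, X_U h1 h2, smul_eq_mul]
    rcases lt_trichotomy i (k - 1) with hi | rfl | hi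
    · rw [if_neg hi.ne, if_neg (by omega), mul_zero, add_zero]
      obtain ⟨n, hn⟩ := he
      rcases Nat.even_or_odd i with he | ho
      · obtain ⟨m, hm⟩ := he
        have := hcon (2 * (m - 1) + 1) (by omega) (by omega)
        rw [form_U_odd (by omega), X_U (by omega) le_rfl, if_neg (by omega), mul_zero,
          add_zero] at this
        convert this using 3
        omega
      · obtain ⟨m, rfl⟩ := ho
        have := hcon (2 * m + 2) (by omega) (by omega)
        rwa [form_U_even (by omega), X_U (by omega) le_rfl, if_neg (by omega), mul_zero,
          add_zero] at this
    · rw [if_pos rfl, if_neg (by omega), mul_one, add_zero]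
    · obtain rfl : i = k := by omega
      rw [if_neg (by omega), if_pos rfl, mul_zero, zero_add, hx.1.1]
  · obtain ⟨n, rfl⟩ := ho
    refine ⟨2 * (n - 1) + 1, by omega, by omega, ?_⟩
    rw [form_U_odd (by omega), X_U (by omega) le_rfl, if_neg (by omega), mul_zero, add_zero]
    convert X_ne_zero_of_mem_affineSet hx.1 using 3
    omega

theorem two_mul_ncard_affineSet_inter_orthogonal [Fintype F] [CharP F 2]
    (hF : Fintype.card F = 2 ^ h) (ht : t₀ ∈ T F h) (hk : 3 ≤ k) {x : Fin k → F}
    (hx : x ∈ affineSet k h t₀ \ (lineSubmodule F k : Set _)) :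
    2 * {z ∈ affineSet k h t₀ | form F k x z = 0}.ncard = Fintype.card F ^ (k - 2) := by
  obtain ⟨w, hw1, hw2, hw3⟩ := exists_form_ne_zero hk hx
  have hsurj : Function.Surjective ((X F k k).prod ((form F k x).prod (X F k (k - 1)))) :=
    fun p => by
    set z₀ := p.1 • U F k k + p.2.2 • U F k (k - 1)
    have h1 : X F k k z₀ = p.1 := by
      simp only [z₀, map_add, map_smul]
      rw [X_U (by omega) le_rfl, X_U (by omega) le_rfl, if_pos rfl, if_neg (by omega)]
      simp
    have h2 : X F k (k - 1) z₀ = p.2.2 := by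
      simp only [z₀, map_add, map_smul]
      rw [X_U (by omega) (by omega), X_U (by omega) (by omega), if_neg (by omega), if_pos rfl]
      simp
    refine ⟨z₀ + ((p.2.1 - form F k x z₀) / form F k x w) • w,
      Prod.ext ?_ (Prod.ext ?_ ?_)⟩
    · change X F k k _ = p.1
      rw [map_add, map_smul, hw1, h1, smul_zero, add_zero]
    · change form F k x _ = p.2.1
      rw [map_add, map_smul, smul_eq_mul, div_mul_cancel₀ _ hw3, add_sub_cancel]
    · change X F k (k - 1) _ = p.2.2
      rw [map_add, map_smul, hw2, h2, smul_zero, add_zero]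
  have hpre : {z ∈ affineSet k h t₀ | form F k x z = 0}
      = (X F k k).prod ((form F k x).prod (X F k (k - 1))) ⁻¹'
          ({1} ×ˢ {0} ×ˢ {s : F | t₀ * s ∈ T F h}) := by
    ext z
    exact ⟨fun h => ⟨h.1.1, h.2, h.1.2⟩, fun h => ⟨⟨h.1, h.2.2⟩, h.2.1⟩⟩
  have hcard := LinearMap.ncard_preimage_mul_card _ hsurj ({1} ×ˢ {0} ×ˢ {s : F | t₀ * s ∈ T F h})
  have hT := two_mul_ncard_mul_mem_T hF ht
  rw [← hpre, Set.ncard_prod, Set.ncard_prod, Set.ncard_singleton, Set.ncard_singleton, one_mul,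
    one_mul, Nat.card_prod, Nat.card_prod, Nat.card_eq_fintype_card, Nat.card_eq_fintype_card,
    Fintype.card_fun, Fintype.card_fin] at hcard
  have hq : 0 < Fintype.card F * (Fintype.card F * Fintype.card F) :=
    Nat.mul_pos Fintype.card_pos (Nat.mul_pos Fintype.card_pos Fintype.card_pos)
  refine Nat.eq_of_mul_eq_mul_right hq ?_
  rw [mul_assoc, hcard, ← mul_assoc, hT, ← mul_assoc, ← mul_assoc, ← pow_succ, ← pow_succ,
    ← pow_succ, ← pow_succ']
  congr 1
  omega

theorem form_ne_zero_of_mem_lineSubmodule [Fintype F] [CharP F 2]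
    (hF : Fintype.card F = 2 ^ h) (ht : t₀ ∈ T F h) (hk : 3 ≤ k) {x z : Fin k → F}
    (hx : x ∈ affineSet k h t₀) (hz : z ∈ affineSet k h t₀) (hzL : z ∈ lineSubmodule F k) :
    form F k x z ≠ 0 := by
  rcases Nat.even_or_odd k with he | ho
  · have hz' := (mem_lineSubmodule_iff hk he hz.1).1 hzL
    obtain ⟨n, hn⟩ := he
    have h1 : form F k x (U F k (k - 1)) = X F k k x := by
      have := form_U_odd (F := F) (k := k) (m := n - 1) (by omega) x
      rw [X_U (by omega) le_rfl, if_neg (by omega), mul_zero, add_zero,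
        show 2 * (n - 1) + 1 = k - 1 by omega, show 2 * (n - 1) + 2 = k by omega] at this
      exact this
    have h2 : form F k x (U F k k) = X F k (k - 1) x + X F k k x := by
      have := form_U_even (F := F) (k := k) (m := n - 1) (by omega) x
      rw [X_U (by omega) le_rfl, if_pos (by omega), mul_one,
        show 2 * (n - 1) + 1 = k - 1 by omega, show 2 * (n - 1) + 2 = k by omega] at this
      exact this
    rw [hz', map_add, map_smul, h1, h2, hx.1, smul_eq_mul, mul_one]
    intro h0
    -- Orthogonality would give `t₀ X_{k-1}(z) + t₀ = t₀ X_{k-1}(x)`, with trace `1 + 1 = 0` on the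
    -- left and `1` on the right.
    have h3 := mt (add_mem_T_iff hF ht (t₀ * X F k (k - 1) z)).1 (not_not.2 hz.2)
    have h4 : t₀ * X F k (k - 1) z + t₀ = t₀ * X F k (k - 1) x := by
      rw [← CharTwo.add_eq_zero]
      linear_combination t₀ * h0
    exact h3 (h4 ▸ hx.2)
  · exact absurd hzL (Set.disjoint_left.1 (disjoint_affineSet_lineSubmodule hk ho) hz)

theorem notMem_perpHyperplane_self [CharP F 2] {x : ℙ F (Fin k → F)}
    (hx : x ∈ vertexSet k h t₀) : x ∉ perpHyperplane (form F k) x := by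
  have hx' := (mem_vertexSet_iff.1 hx).1
  rw [mem_perpHyperplane_iff hx' hx', form_self, X_affineRep hx', mul_one]
  exact one_ne_zero

theorem two_mul_ncard_neighborSet [Fintype F] [CharP F 2] (hF : Fintype.card F = 2 ^ h)
    (ht : t₀ ∈ T F h) (hk : 3 ≤ k) (x : vertexSet k h t₀) :
    2 * ((graph k h t₀).neighborSet x).ncard = Fintype.card F ^ (k - 2) := by
  obtain ⟨hx, hxA⟩ := mem_vertexSet_iff.1 x.2
  rw [← two_mul_ncard_affineSet_inter_orthogonal hF ht hk hxA]
  congr 1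
  have hb := bijOn_affineRep_vertexSet (F := F) (k := k) (h := h) (t₀ := t₀)
  refine Set.ncard_congr (fun y _ => affineRep F k y.1) (fun y hy => ?_) (fun y z _ _ hyz => ?_)
    fun z hz => ?_
  · obtain ⟨hy', hyA⟩ := mem_vertexSet_iff.1 y.2
    have := (mem_perpHyperplane_iff hx hy').1 hy.2
    exact ⟨hyA.1, ((form_isSymm F k).eq _ _).symm.trans this⟩
  · exact Subtype.ext (hb.injOn y.2 z.2 hyz)
  -- A solution `z` is never on `ℓ`, so it comes from a vertex, and that vertex differs from `x`
  -- because `x` is not absolute.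
  · obtain ⟨p, hp, rfl⟩ := hb.surjOn ⟨hz.1, fun hzL =>
      form_ne_zero_of_mem_lineSubmodule hF ht hk hxA.1 hz.1 hzL hz.2⟩
    have h1 := (mem_perpHyperplane_iff hx (mem_vertexSet_iff.1 hp).1).2
      (((form_isSymm F k).eq _ _).symm.trans hz.2)
    refine ⟨⟨p, hp⟩, ⟨fun h0 => ?_, h1⟩, rfl⟩
    obtain rfl : x.1 = p := h0
    exact notMem_perpHyperplane_self hp h1

theorem two_mul_ncard_vertexSet_of_odd [Fintype F] [CharP F 2] (hF : Fintype.card F = 2 ^ h)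
    (ht : t₀ ∈ T F h) (hk : 3 ≤ k) (ho : Odd k) :
    2 * (vertexSet k h t₀).ncard = Fintype.card F ^ (k - 1) := by
  rw [← two_mul_ncard_affineSet hF ht hk, bijOn_affineRep_vertexSet.ncard_eq,
    (disjoint_affineSet_lineSubmodule hk ho).sdiff_eq_left]

theorem two_mul_ncard_vertexSet_of_even [Fintype F] [CharP F 2] (hF : Fintype.card F = 2 ^ h)
    (ht : t₀ ∈ T F h) (hk : 3 ≤ k) (he : Even k) :
    2 * (vertexSet k h t₀).ncard = Fintype.card F ^ (k - 1) - Fintype.card F := by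
  rw [← two_mul_ncard_affineSet hF ht hk, ← two_mul_ncard_mul_mem_T hF ht,
    ← ncard_affineSet_inter_lineSubmodule hk he, bijOn_affineRep_vertexSet.ncard_eq]
  have := Set.ncard_inter_add_ncard_sdiff_eq_ncard (affineSet k h t₀)
    (lineSubmodule F k : Set (Fin k → F)) (Set.toFinite _)
  omega

theorem isNDLambdaGraph_graph [Fintype F] [CharP F 2] (hF : Fintype.card F = 2 ^ h)
    (ht : t₀ ∈ T F h) (hk : 3 ≤ k) {n : ℕ} (hn : (vertexSet k h t₀).ncard = n) :
    IsNDLambdaGraph (graph k h t₀) n (Fintype.card F ^ (k - 2) / 2)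
      (√((Fintype.card F : ℝ) ^ (k - 2))) := by
  classical
  have := Fintype.ofFinite (vertexSet k h t₀)
  refine IsNDLambdaGraph.of_sum_sq_le (by rw [Nat.card_coe_set_eq, hn]) (fun x => ?_)
    (Real.sqrt_nonneg _) fun f hf => ?_
  · rw [← two_mul_ncard_neighborSet hF ht hk x, Nat.mul_div_cancel_left _ two_pos]
  · have := polarityGraph_induce_sum_sq_le (form_isSymm F k) (form_nondegenerate (by omega))
      (by rw [Module.finrank_fin_fun]; omega) (vertexSet k h t₀)
      (fun x hx => notMem_perpHyperplane_self hx) f hf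
    rw [Module.finrank_fin_fun] at this
    rw [Real.sq_sqrt (by positivity)]
    exact this

end Counting

end PseudoPolarity

/-! ### Assembly of the parameters. -/

theorem mainTheorem1 :
    ∃ C : ℝ, ∀ (F : Type*) [Field F] [Fintype F] (h q : ℕ), q = 2 ^ h → Fintype.card F = q →
      ∀ t₀ ∈ PseudoPolarity.T F h, ∀ k : ℕ, 3 ≤ k →
        ∃ lam : ℝ, lam ≤ C * √((q : ℝ) ^ (k - 2) / 2) ∧
          (Odd k →
            IsNDLambdaGraph (PseudoPolarity.graph k h t₀) (q ^ (k - 1) / 2) (q ^ (k - 2) / 2) lam) ∧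
          (Even k →
            IsNDLambdaGraph (PseudoPolarity.graph k h t₀)
              ((q ^ (k - 1) - q) / 2) (q ^ (k - 2) / 2) lam) := by
  refine ⟨√2, fun F _ _ h q hq hF t₀ ht k hk => ⟨√((q : ℝ) ^ (k - 2)), ?_, ?_⟩⟩
  · rw [← Real.sqrt_mul zero_le_two, mul_div_cancel₀ _ two_ne_zero]
  subst hF
  have : CharP F 2 := charP_of_card_eq_prime_pow hq
  refine ⟨fun ho => ?_, fun he => ?_⟩
  · refine PseudoPolarity.isNDLambdaGraph_graph hq ht hk ?_
    rw [← PseudoPolarity.two_mul_ncard_vertexSet_of_odd hq ht hk ho,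
      Nat.mul_div_cancel_left _ two_pos]
  · refine PseudoPolarity.isNDLambdaGraph_graph hq ht hk ?_
    rw [← PseudoPolarity.two_mul_ncard_vertexSet_of_even hq ht hk he,
      Nat.mul_div_cancel_left _ two_pos]
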